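/- A *$2$-marked Durfee symbol of $n$* consists of an integer $d\ge 0$ and two finite rows of positive integers (parts) $d\ge a_1\ge\cdots\ge a_m\ge 1$ (top row) and $d\ge b_1\ge\cdots\ge b_\ell\ge 1$ (bottom row; it may be empty) with $d^2+\sum_{i=1}^m a_i+\sum_{j=1}^{\ell} b_j=n$, where each part carries a subscript from $\{1,2\}$, such that: in each row the sequence of subscripts is non-increasing; the subscript $1$ occurs at least once in the top row; and, if $M$ is the largest part with subscript $1$ in the top row, then all bottom parts with subscript $1$ lie in $[1,M]$ and all bottom parts with subscript $2$ lie in $[M,d]$. For $i\in\{1,2\}$ let $\tau_i$ and $\beta_i$ be the numbers of entries with subscript $i$ in the top and in the bottom row, respectively, and put $\rho_1=\tau_1-\beta_1-1$ and $\rho_2=\tau_2-\beta_2$. The *full rank* of the symbol is $\rho_1+2\rho_2$. Let $NF_2(r,t;n)$ be the number of $2$-marked Durfee symbols of $n$ with full rank congruent to $r$ modulo $t$, and let $NF_2(r;n)$ be the number of those with full rank equal to $r$. **Theorem 1.3.** 1. For every odd positive integer $t$ and every integer $n\ge 0$, $$NF_2(1,t;n)=NF_2(2,t;n).$$ 2.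 For every even positive integer $t$ and every integer $n\ge 0$, $$NF_2(1,t;n)\le NF_2(2,t;n),$$ and equality holds if and only if $n\in\{0,1,\dots,\tfrac t2\}\cup\{\tfrac t2+2\}$. 3. For every integer $n\ge 0$, $$NF_2(1;n)=NF_2(2;n).$$ -/

import Mathlib

/-- The largest part with subscript `i` in a row of subscripted parts. A row is a list of pairs
`(part, subscript)`. The value is `0` if no entry of the row has subscript `i`. -/
def largestPart (row : List (ℕ × ℕ)) (i : ℕ) : ℕ :=
  ((row.filter fun x => x.2 = i).map Prod.fst).foldr max 0

/-- The number of entries with subscript `i` in a row of subscripted parts. -/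
def subscriptCount (row : List (ℕ × ℕ)) (i : ℕ) : ℕ :=
  row.countP fun x => x.2 = i

/-- The sum of the parts of a row of subscripted parts. -/
def rowSum (row : List (ℕ × ℕ)) : ℕ :=
  (row.map Prod.fst).sum

/-- A `k`-marked Durfee symbol: the side `side` of the Durfee square and two rows of entries
`(part, subscript)`, the parts being integers in `[1, side]` and the subscripts lying in `[1, k]`. -/
@[ext]
structure MarkedDurfeeSymbol (k : ℕ) where
  side : ℕ
  top : List (ℕ × ℕ)
  bottom : List (ℕ × ℕ)
  top_part_mem : ∀ x ∈ top, 1 ≤ x.1 ∧ x.1 ≤ side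
  bottom_part_mem : ∀ x ∈ bottom, 1 ≤ x.1 ∧ x.1 ≤ side
  top_subscript_mem : ∀ x ∈ top, 1 ≤ x.2 ∧ x.2 ≤ k
  bottom_subscript_mem : ∀ x ∈ bottom, 1 ≤ x.2 ∧ x.2 ≤ k
  /-- In each row the parts and the subscripts are non-increasing. -/
  top_nonincreasing : top.Pairwise fun x y => y.1 ≤ x.1 ∧ y.2 ≤ x.2
  bottom_nonincreasing : bottom.Pairwise fun x y => y.1 ≤ x.1 ∧ y.2 ≤ x.2
  /-- Each of the subscripts `1, …, k - 1` occurs in the top row. -/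
  subscript_occurs : ∀ i, 1 ≤ i → i < k → ∃ x ∈ top, x.2 = i
  /-- A part of the bottom row with subscript `j ≥ 2` is at least the largest part with subscript
  `j - 1` of the top row. -/
  le_bottom : ∀ x ∈ bottom, 2 ≤ x.2 → largestPart top (x.2 - 1) ≤ x.1
  /-- A part of the bottom row with subscript `j < k` is at most the largest part with subscript
  `j` of the top row. -/
  bottom_le : ∀ x ∈ bottom, x.2 < k → x.1 ≤ largestPart top x.2

namespace MarkedDurfeeSymbol

variable {k : ℕ}

/-- The integer `n` of which `δ` is a `k`-marked Durfee symbol. -/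
def size (δ : MarkedDurfeeSymbol k) : ℕ :=
  δ.side ^ 2 + rowSum δ.top + rowSum δ.bottom

/-- The `i`-th rank of a `k`-marked Durfee symbol. -/
def rank (δ : MarkedDurfeeSymbol k) (i : ℕ) : ℤ :=
  if i < k then (subscriptCount δ.top i : ℤ) - subscriptCount δ.bottom i - 1
  else (subscriptCount δ.top i : ℤ) - subscriptCount δ.bottom i

/-- The full rank of a `k`-marked Durfee symbol. -/
def fullRank (δ : MarkedDurfeeSymbol k) : ℤ :=
  ∑ i ∈ Finset.Icc 1 k, (i : ℤ) * δ.rank i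

end MarkedDurfeeSymbol

/-- `fullRankModCount k r t n` is `NF_k(r, t; n)`: the number of `k`-marked Durfee symbols of `n`
with full rank congruent to `r` modulo `t`. -/
noncomputable def fullRankModCount (k : ℕ) (r : ℤ) (t n : ℕ) : ℕ :=
  {δ : MarkedDurfeeSymbol k | δ.size = n ∧ δ.fullRank ≡ r [ZMOD t]}.ncard

/-- `fullRankCount k r n` is `NF_k(r; n)`: the number of `k`-marked Durfee symbols of `n` with
full rank equal to `r`. -/
noncomputable def fullRankCount (k : ℕ) (r : ℤ) (n : ℕ) : ℕ :=
  {δ : MarkedDurfeeSymbol k | δ.size = n ∧ δ.fullRank = r}.ncard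

theorem length_le_rowSum (row : List (ℕ × ℕ)) (h : ∀ x ∈ row, 1 ≤ x.1) :
    row.length ≤ rowSum row := by
  induction row with
  | nil => simp [rowSum]
  | cons a l ih =>
    have h1 := ih fun x hx => h x (List.mem_cons_of_mem _ hx)
    have h2 := h a List.mem_cons_self
    simp only [rowSum, List.map_cons, List.sum_cons, List.length_cons] at h1 ⊢
    omega

/-- There are finitely many `k`-marked Durfee symbols of `n`, so that the counts above are the
cardinalities of finite sets. -/
theorem finite_markedDurfeeSymbol_size (k n : ℕ) :
    {δ : MarkedDurfeeSymbol k | δ.size = n}.Finite := by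
  let A : Set (List (ℕ × ℕ)) :=
    {l | l.length ≤ n ∧ ∀ x ∈ l, x ∈ Set.Iic n ×ˢ Set.Iic k}
  have hA : A.Finite := by
    have hfin : (Set.Iic n ×ˢ Set.Iic k : Set (ℕ × ℕ)).Finite :=
      (Set.finite_Iic n).prod (Set.finite_Iic k)
    have := hfin.to_subtype
    refine ((List.finite_length_le (Set.Iic n ×ˢ Set.Iic k : Set (ℕ × ℕ)) n).image
      (List.map Subtype.val)).subset ?_
    rintro l ⟨hl, hm⟩
    refine ⟨l.attach.map fun x => ⟨x.1, hm x.1 x.2⟩, ?_, ?_⟩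
    · rw [Set.mem_ofPred_eq, List.length_map, List.length_attach]
      exact hl
    · rw [List.map_map]
      exact List.attach_map_subtype_val l
  refine Set.Finite.of_injOn (f := fun δ : MarkedDurfeeSymbol k => (δ.side, δ.top, δ.bottom))
    (t := Set.Iic n ×ˢ (A ×ˢ A)) ?_ ?_ ((Set.finite_Iic n).prod (hA.prod hA))
  · intro δ hδ
    have hs : δ.side ^ 2 + rowSum δ.top + rowSum δ.bottom = n := hδ
    have h0 : δ.side ≤ δ.side ^ 2 := Nat.le_self_pow (by norm_num) _
    have h1 := length_le_rowSum δ.top fun x hx => (δ.top_part_mem x hx).1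
    have h2 := length_le_rowSum δ.bottom fun x hx => (δ.bottom_part_mem x hx).1
    refine ⟨?_, ⟨?_, fun x hx => ⟨?_, ?_⟩⟩, ⟨?_, fun x hx => ⟨?_, ?_⟩⟩⟩
    · change δ.side ≤ n
      omega
    · change δ.top.length ≤ n
      omega
    · have := (δ.top_part_mem x hx).2
      change x.1 ≤ n
      omega
    · exact (δ.top_subscript_mem x hx).2
    · change δ.bottom.length ≤ n
      omega
    · have := (δ.bottom_part_mem x hx).2
      change x.1 ≤ n
      omega
    · exact (δ.bottom_subscript_mem x hx).2
  · intro δ _ ε _ h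
    simp only [Prod.mk.injEq] at h
    exact MarkedDurfeeSymbol.ext h.1 h.2.1 h.2.2

/-! Fix the side `d` and the mark `m`. Let `F_j(z)` be the generating function of the marked tuples,
`z` recording the rank and `m` being counted `j` times in the size; `F_1` is that of the `2`-marked
Durfee symbols. Forbidding the value `m` among the entries with subscript `1` multiplies each term
by `(1 - z q^m)(1 - z⁻¹ q^m)`, which turns `F_0` into `F_0 - (z + z⁻¹) F_1 + F_2`. Forbidding it
among the entries with subscript `2` gives the same with `z²` for `z`.

Both results count Durfee symbols cut at a height into small and large entries: after `m` is lowered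
by one, the first misses only the cut at `d`, and the second misses only the cut at `0`. Their
difference telescopes to `R(z²) - R(z)`, where `R` is the rank generating function of Durfee
symbols. This is `ncard_markedLevel_relation`.

Extract the ranks divisible by `t`. Since negating the rank is a symmetry, twice the difference of
the counts for `2` and `1` is the number of Durfee symbols with `t ∣ 2r` minus the number with `t ∣
r`, where `r` is the rank. This vanishes for odd `t`. For `t = 2s` it is the number with `r ≡ s`
modulo `2s`, and `durfeeLevel_nonempty_iff` decides when that is zero. Rank exactly `0` gives the
last claim. -/

/-- The data of a `2`-marked Durfee symbol with the entries sorted by row and subscript, the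
largest entry `mark` with subscript `1` of the top row being kept apart. -/
@[ext]
structure DurfeeParts where
  side : ℕ
  mark : ℕ
  top₁ : Multiset ℕ
  bot₁ : Multiset ℕ
  top₂ : Multiset ℕ
  bot₂ : Multiset ℕ

namespace DurfeeParts

/-- The integer represented, not counting the entry `mark`. -/
def size (s : DurfeeParts) : ℕ :=
  s.side ^ 2 + s.top₁.sum + s.bot₁.sum + s.top₂.sum + s.bot₂.sum

/-- The full rank, not counting the entry `mark`. -/
def rank (s : DurfeeParts) : ℤ :=
  (s.top₁.card : ℤ) - s.bot₁.card + 2 * ((s.top₂.card : ℤ) - s.bot₂.card)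

/-- The tuple comes from a `2`-marked Durfee symbol. -/
def Marked (s : DurfeeParts) : Prop :=
  (1 ≤ s.mark ∧ s.mark ≤ s.side) ∧
  (∀ x ∈ s.top₁, 1 ≤ x ∧ x ≤ s.mark) ∧ (∀ x ∈ s.bot₁, 1 ≤ x ∧ x ≤ s.mark) ∧
  (∀ x ∈ s.top₂, s.mark ≤ x ∧ x ≤ s.side) ∧ (∀ x ∈ s.bot₂, s.mark ≤ x ∧ x ≤ s.side)

/-- The tuple is a Durfee symbol whose entries are separated by `mark`. -/
def Split (s : DurfeeParts) : Prop :=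
  s.mark ≤ s.side ∧
  (∀ x ∈ s.top₁, 1 ≤ x ∧ x ≤ s.mark) ∧ (∀ x ∈ s.bot₁, 1 ≤ x ∧ x ≤ s.mark) ∧
  (∀ x ∈ s.top₂, s.mark < x ∧ x ≤ s.side) ∧ (∀ x ∈ s.bot₂, s.mark < x ∧ x ≤ s.side)

/-! ### Finiteness of the sets to be counted -/

theorem finite_multiset_sum_le (n : ℕ) :
    {A : Multiset ℕ | (∀ x ∈ A, 1 ≤ x) ∧ A.sum ≤ n}.Finite := by
  -- Parts are at most `n`, and so are multiplicities, since they are bounded by the cardinality and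
  -- hence by the sum.
  refine (Set.finite_Iic (n • Multiset.range (n + 1))).subset ?_
  rintro A ⟨h1, h2⟩
  have hcard : A.card ≤ A.sum := by
    simpa using Multiset.card_nsmul_le_sum (s := A) (a := 1) h1
  refine Multiset.le_iff_count.2 fun x => ?_
  by_cases hx : x ∈ A
  · have hxn : x ≤ n := (Multiset.le_sum_of_mem hx).trans h2
    have : Multiset.count x (Multiset.range (n + 1)) = 1 :=
      Multiset.count_eq_one_of_mem (Multiset.nodup_range _) (Multiset.mem_range.2 (by omega))
    rw [Multiset.count_nsmul, this]
    have := Multiset.count_le_card x A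
    omega
  · simp [Multiset.count_eq_zero_of_notMem hx]

theorem finite_size_le (n : ℕ) :
    {s : DurfeeParts | s.mark ≤ s.side ∧ (∀ x ∈ s.top₁, 1 ≤ x) ∧ (∀ x ∈ s.bot₁, 1 ≤ x) ∧
      (∀ x ∈ s.top₂, 1 ≤ x) ∧ (∀ x ∈ s.bot₂, 1 ≤ x) ∧ s.size ≤ n}.Finite := by
  have hF := finite_multiset_sum_le n
  refine Set.Finite.of_injOn
    (f := fun s : DurfeeParts => (s.side, s.mark, s.top₁, s.bot₁, s.top₂, s.bot₂)) ?_ ?_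
    ((Set.finite_Iic n).prod ((Set.finite_Iic n).prod (hF.prod (hF.prod (hF.prod hF)))))
  · rintro s ⟨h0, h1, h2, h3, h4, h5⟩
    have : s.side ≤ s.side ^ 2 := Nat.le_self_pow (by norm_num) _
    unfold size at h5
    refine ⟨?_, ?_, ⟨h1, ?_⟩, ⟨h2, ?_⟩, ⟨h3, ?_⟩, h4, ?_⟩
    · change s.side ≤ n
      omega
    · change s.mark ≤ n
      omega
    all_goals dsimp only; omega
  · intro s _ u _ h
    simp only [Prod.mk.injEq] at h
    obtain ⟨h1, h2, h3, h4, h5, h6⟩ := h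
    exact DurfeeParts.ext h1 h2 h3 h4 h5 h6

theorem finite_marked (n : ℕ) : {s : DurfeeParts | s.Marked ∧ s.size ≤ n}.Finite := by
  refine (finite_size_le n).subset ?_
  rintro s ⟨⟨⟨h0, h1⟩, h2, h3, h4, h5⟩, h6⟩
  exact ⟨h1, fun x hx => (h2 x hx).1, fun x hx => (h3 x hx).1,
    fun x hx => h0.trans (h4 x hx).1, fun x hx => h0.trans (h5 x hx).1, h6⟩

theorem finite_split (n : ℕ) : {s : DurfeeParts | s.Split ∧ s.size ≤ n}.Finite := by
  refine (finite_size_le n).subset ?_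
  rintro s ⟨⟨h1, h2, h3, h4, h5⟩, h6⟩
  exact ⟨h1, fun x hx => (h2 x hx).1, fun x hx => (h3 x hx).1,
    fun x hx => (Nat.zero_le _).trans_lt (h4 x hx).1,
    fun x hx => (Nat.zero_le _).trans_lt (h5 x hx).1, h6⟩

/-! ### Adjoining and removing a copy of the mark -/

/-- Adjoin `mark` to the entries with subscript `1` of the top row. -/
def addTop₁ (s : DurfeeParts) : DurfeeParts := { s with top₁ := s.mark ::ₘ s.top₁ }

/-- Adjoin `mark` to the entries with subscript `1` of the bottom row. -/
def addBot₁ (s : DurfeeParts) : DurfeeParts := { s with bot₁ := s.mark ::ₘ s.bot₁ }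

/-- Adjoin `mark` to the entries with subscript `2` of the top row. -/
def addTop₂ (s : DurfeeParts) : DurfeeParts := { s with top₂ := s.mark ::ₘ s.top₂ }

/-- Adjoin `mark` to the entries with subscript `2` of the bottom row. -/
def addBot₂ (s : DurfeeParts) : DurfeeParts := { s with bot₂ := s.mark ::ₘ s.bot₂ }

/-- Common part of the four bijections below. The set `Z` is arbitrary so that a second condition,
such as membership of the mark in the other row, can be absorbed into it. -/
theorem ncard_marked_of_injective {f : DurfeeParts → DurfeeParts} {p : DurfeeParts → Prop}
    (hf : Function.Injective f) (hm : ∀ s, s.Marked → (f s).Marked ∧ p (f s))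
    (hs : ∀ s, s.Marked → p s → ∃ u, u.Marked ∧ f u = s) (Z : Set DurfeeParts) :
    {s : DurfeeParts | s.Marked ∧ p s ∧ s ∈ Z}.ncard = {s : DurfeeParts | s.Marked ∧ f s ∈ Z}.ncard := by
  rw [← Set.ncard_image_of_injective {s : DurfeeParts | s.Marked ∧ f s ∈ Z} hf]
  congr 1
  ext s
  constructor
  · rintro ⟨h1, h2, h3⟩
    obtain ⟨u, hu, rfl⟩ := hs s h1 h2
    exact ⟨u, ⟨hu, h3⟩, rfl⟩
  · rintro ⟨u, ⟨hu, hz⟩, rfl⟩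
    exact ⟨(hm u hu).1, (hm u hu).2, hz⟩

theorem ncard_mark_mem_top₁ (Z : Set DurfeeParts) :
    {s : DurfeeParts | s.Marked ∧ s.mark ∈ s.top₁ ∧ s ∈ Z}.ncard =
      {s : DurfeeParts | s.Marked ∧ s.addTop₁ ∈ Z}.ncard := by
  refine ncard_marked_of_injective (p := fun s => s.mark ∈ s.top₁) ?_ ?_ ?_ Z
  · rintro ⟨⟩ ⟨⟩ h
    simp only [addTop₁, mk.injEq] at h
    obtain ⟨rfl, rfl, h, rfl, rfl, rfl⟩ := h
    simpa using h
  · rintro s ⟨h0, h1, h2, h3, h4⟩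
    refine ⟨⟨h0, ?_, h2, h3, h4⟩, by simp [addTop₁]⟩
    simpa [addTop₁, h0] using h1
  · rintro s ⟨h0, h1, h2, h3, h4⟩ h
    refine ⟨{ s with top₁ := s.top₁.erase s.mark },
      ⟨h0, fun x hx => h1 x (Multiset.mem_of_mem_erase hx), h2, h3, h4⟩, ?_⟩
    simp [addTop₁, Multiset.cons_erase h]

theorem ncard_mark_mem_bot₁ (Z : Set DurfeeParts) :
    {s : DurfeeParts | s.Marked ∧ s.mark ∈ s.bot₁ ∧ s ∈ Z}.ncard =
      {s : DurfeeParts | s.Marked ∧ s.addBot₁ ∈ Z}.ncard := by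
  refine ncard_marked_of_injective (p := fun s => s.mark ∈ s.bot₁) ?_ ?_ ?_ Z
  · rintro ⟨⟩ ⟨⟩ h
    simp only [addBot₁, mk.injEq] at h
    obtain ⟨rfl, rfl, rfl, h, rfl, rfl⟩ := h
    simpa using h
  · rintro s ⟨h0, h1, h2, h3, h4⟩
    refine ⟨⟨h0, h1, ?_, h3, h4⟩, by simp [addBot₁]⟩
    simpa [addBot₁, h0] using h2
  · rintro s ⟨h0, h1, h2, h3, h4⟩ h
    refine ⟨{ s with bot₁ := s.bot₁.erase s.mark },
      ⟨h0, h1, fun x hx => h2 x (Multiset.mem_of_mem_erase hx), h3, h4⟩, ?_⟩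
    simp [addBot₁, Multiset.cons_erase h]

theorem ncard_mark_mem_top₂ (Z : Set DurfeeParts) :
    {s : DurfeeParts | s.Marked ∧ s.mark ∈ s.top₂ ∧ s ∈ Z}.ncard =
      {s : DurfeeParts | s.Marked ∧ s.addTop₂ ∈ Z}.ncard := by
  refine ncard_marked_of_injective (p := fun s => s.mark ∈ s.top₂) ?_ ?_ ?_ Z
  · rintro ⟨⟩ ⟨⟩ h
    simp only [addTop₂, mk.injEq] at h
    obtain ⟨rfl, rfl, rfl, rfl, h, rfl⟩ := h
    simpa using h
  · rintro s ⟨h0, h1, h2, h3, h4⟩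
    refine ⟨⟨h0, h1, h2, ?_, h4⟩, by simp [addTop₂]⟩
    simpa [addTop₂, h0] using h3
  · rintro s ⟨h0, h1, h2, h3, h4⟩ h
    refine ⟨{ s with top₂ := s.top₂.erase s.mark },
      ⟨h0, h1, h2, fun x hx => h3 x (Multiset.mem_of_mem_erase hx), h4⟩, ?_⟩
    simp [addTop₂, Multiset.cons_erase h]

theorem ncard_mark_mem_bot₂ (Z : Set DurfeeParts) :
    {s : DurfeeParts | s.Marked ∧ s.mark ∈ s.bot₂ ∧ s ∈ Z}.ncard =
      {s : DurfeeParts | s.Marked ∧ s.addBot₂ ∈ Z}.ncard := by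
  refine ncard_marked_of_injective (p := fun s => s.mark ∈ s.bot₂) ?_ ?_ ?_ Z
  · rintro ⟨⟩ ⟨⟩ h
    simp only [addBot₂, mk.injEq] at h
    obtain ⟨rfl, rfl, rfl, rfl, rfl, h⟩ := h
    simpa using h
  · rintro s ⟨h0, h1, h2, h3, h4⟩
    refine ⟨⟨h0, h1, h2, h3, ?_⟩, by simp [addBot₂]⟩
    simpa [addBot₂, h0] using h4
  · rintro s ⟨h0, h1, h2, h3, h4⟩ h
    refine ⟨{ s with bot₂ := s.bot₂.erase s.mark },
      ⟨h0, h1, h2, h3, fun x hx => h4 x (Multiset.mem_of_mem_erase hx)⟩, ?_⟩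
    simp [addBot₂, Multiset.cons_erase h]

/-- The tuples that represent `n` when `mark` is counted `j` times and whose rank lies in `W`. -/
def level (j n : ℕ) (W : Set ℤ) : Set DurfeeParts :=
  {s | s.size + j * s.mark = n ∧ s.rank ∈ W}

theorem addTop₁_mem_level {s : DurfeeParts} {j n : ℕ} {W : Set ℤ} :
    s.addTop₁ ∈ level j n W ↔ s ∈ level (j + 1) n ((· + 1) ⁻¹' W) := by
  have h1 : s.addTop₁.size + j * s.addTop₁.mark = s.size + (j + 1) * s.mark := by
    simp only [size, addTop₁, Multiset.sum_cons]; ring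
  have h2 : s.addTop₁.rank = s.rank + 1 := by
    simp only [rank, addTop₁, Multiset.card_cons]; push_cast; ring
  simp [level, h1, h2]

theorem addBot₁_mem_level {s : DurfeeParts} {j n : ℕ} {W : Set ℤ} :
    s.addBot₁ ∈ level j n W ↔ s ∈ level (j + 1) n ((· - 1) ⁻¹' W) := by
  have h1 : s.addBot₁.size + j * s.addBot₁.mark = s.size + (j + 1) * s.mark := by
    simp only [size, addBot₁, Multiset.sum_cons]; ring
  have h2 : s.addBot₁.rank = s.rank - 1 := by
    simp only [rank, addBot₁, Multiset.card_cons]; push_cast; ring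
  simp [level, h1, h2]

theorem addTop₂_mem_level {s : DurfeeParts} {j n : ℕ} {W : Set ℤ} :
    s.addTop₂ ∈ level j n W ↔ s ∈ level (j + 1) n ((· + 2) ⁻¹' W) := by
  have h1 : s.addTop₂.size + j * s.addTop₂.mark = s.size + (j + 1) * s.mark := by
    simp only [size, addTop₂, Multiset.sum_cons]; ring
  have h2 : s.addTop₂.rank = s.rank + 2 := by
    simp only [rank, addTop₂, Multiset.card_cons]; push_cast; ring
  simp [level, h1, h2]

theorem addBot₂_mem_level {s : DurfeeParts} {j n : ℕ} {W : Set ℤ} :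
    s.addBot₂ ∈ level j n W ↔ s ∈ level (j + 1) n ((· - 2) ⁻¹' W) := by
  have h1 : s.addBot₂.size + j * s.addBot₂.mark = s.size + (j + 1) * s.mark := by
    simp only [size, addBot₂, Multiset.sum_cons]; ring
  have h2 : s.addBot₂.rank = s.rank - 2 := by
    simp only [rank, addBot₂, Multiset.card_cons]; push_cast; ring
  simp [level, h1, h2]

/-! ### Inclusion–exclusion on the occurrences of the mark -/

theorem ncard_inclusion_exclusion {α : Type*} {S : Set α} (hS : S.Finite) (p q : α → Prop) :
    S.ncard + {s ∈ S | p s ∧ q s}.ncard =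
      {s ∈ S | ¬ p s ∧ ¬ q s}.ncard + {s ∈ S | p s}.ncard + {s ∈ S | q s}.ncard := by
  have hp : {s ∈ S | p s}.Finite := hS.subset fun _ h => h.1
  have hq : {s ∈ S | q s}.Finite := hS.subset fun _ h => h.1
  have h1 := Set.ncard_union_add_ncard_inter _ _ hp hq
  have h2 := Set.ncard_sdiff_add_ncard_of_subset
    (s := {s ∈ S | p s} ∪ {s ∈ S | q s}) (t := S)
    (Set.union_subset (fun _ h => h.1) (fun _ h => h.1)) hS
  have h3 : {s ∈ S | p s} ∩ {s ∈ S | q s} = {s ∈ S | p s ∧ q s} := by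
    ext s
    simp only [Set.mem_inter_iff, Set.mem_ofPred_eq]
    tauto
  have h4 : S \ ({s ∈ S | p s} ∪ {s ∈ S | q s}) = {s ∈ S | ¬ p s ∧ ¬ q s} := by
    ext s
    simp only [Set.mem_sdiff, Set.mem_union, Set.mem_ofPred_eq]
    tauto
  rw [h3] at h1
  rw [h4] at h2
  omega

/-- The marked tuples in `level j n W`. -/
def markedLevel (j n : ℕ) (W : Set ℤ) : Set DurfeeParts := {s | s.Marked ∧ s ∈ level j n W}

theorem finite_markedLevel (j n : ℕ) (W : Set ℤ) : (markedLevel j n W).Finite := by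
  refine (finite_marked n).subset ?_
  rintro s ⟨h1, h2, -⟩
  exact ⟨h1, by omega⟩

/-- Coefficient form of multiplication by `1 - (z + z⁻¹) q^m + q^{2m}`, with the negative terms
moved across to stay in `ℕ`. -/
theorem ncard_markedLevel_subscript_one (n : ℕ) (W : Set ℤ) :
    (markedLevel 0 n W).ncard + (markedLevel 2 n W).ncard =
      {s ∈ markedLevel 0 n W | s.mark ∉ s.top₁ ∧ s.mark ∉ s.bot₁}.ncard +
      (markedLevel 1 n ((· + 1) ⁻¹' W)).ncard + (markedLevel 1 n ((· - 1) ⁻¹' W)).ncard := by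
  have h := ncard_inclusion_exclusion (finite_markedLevel 0 n W)
    (fun s => s.mark ∈ s.top₁) (fun s => s.mark ∈ s.bot₁)
  have h1 := ncard_mark_mem_top₁ (level 0 n W)
  have h2 := ncard_mark_mem_bot₁ (level 0 n W)
  have h3 := ncard_mark_mem_top₁ {s | s.mark ∈ s.bot₁ ∧ s ∈ level 0 n W}
  have h4 := ncard_mark_mem_bot₁ (level 1 n ((· + 1) ⁻¹' W))
  have e1 : {s ∈ markedLevel 0 n W | s.mark ∈ s.top₁} =
      {s : DurfeeParts | s.Marked ∧ s.mark ∈ s.top₁ ∧ s ∈ level 0 n W} := by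
    ext s; simp only [markedLevel, Set.mem_ofPred_eq]; tauto
  have e2 : {s ∈ markedLevel 0 n W | s.mark ∈ s.bot₁} =
      {s : DurfeeParts | s.Marked ∧ s.mark ∈ s.bot₁ ∧ s ∈ level 0 n W} := by
    ext s; simp only [markedLevel, Set.mem_ofPred_eq]; tauto
  have e3 : {s ∈ markedLevel 0 n W | s.mark ∈ s.top₁ ∧ s.mark ∈ s.bot₁} =
      {s : DurfeeParts | s.Marked ∧ s.mark ∈ s.top₁ ∧
        s ∈ {s : DurfeeParts | s.mark ∈ s.bot₁ ∧ s ∈ level 0 n W}} := by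
    ext s; simp only [markedLevel, Set.mem_ofPred_eq]; tauto
  have e4 : {s : DurfeeParts | s.Marked ∧
      s.addTop₁ ∈ {s : DurfeeParts | s.mark ∈ s.bot₁ ∧ s ∈ level 0 n W}} =
      {s : DurfeeParts | s.Marked ∧ s.mark ∈ s.bot₁ ∧ s ∈ level 1 n ((· + 1) ⁻¹' W)} := by
    ext s; simp only [Set.mem_ofPred_eq, addTop₁_mem_level]; rfl
  simp only [addTop₁_mem_level, addBot₁_mem_level] at h1 h2 h4
  rw [← Set.preimage_comp] at h4
  -- Removing the mark from both rows leaves the rank unchanged, so the doubly removed term keeps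
  -- `W`.
  have hc : ((· + 1) ∘ (· - 1) : ℤ → ℤ) = id := by ext; simp
  rw [hc, Set.preimage_id] at h4
  rw [e1, e2, e3, h1, h2, h3, e4, h4] at h
  exact h

/-- As for subscript `1`, but an entry with subscript `2` shifts the rank by two. -/
theorem ncard_markedLevel_subscript_two (n : ℕ) (W : Set ℤ) :
    (markedLevel 0 n W).ncard + (markedLevel 2 n W).ncard =
      {s ∈ markedLevel 0 n W | s.mark ∉ s.top₂ ∧ s.mark ∉ s.bot₂}.ncard +
      (markedLevel 1 n ((· + 2) ⁻¹' W)).ncard + (markedLevel 1 n ((· - 2) ⁻¹' W)).ncard := by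
  have h := ncard_inclusion_exclusion (finite_markedLevel 0 n W)
    (fun s => s.mark ∈ s.top₂) (fun s => s.mark ∈ s.bot₂)
  have h1 := ncard_mark_mem_top₂ (level 0 n W)
  have h2 := ncard_mark_mem_bot₂ (level 0 n W)
  have h3 := ncard_mark_mem_top₂ {s | s.mark ∈ s.bot₂ ∧ s ∈ level 0 n W}
  have h4 := ncard_mark_mem_bot₂ (level 1 n ((· + 2) ⁻¹' W))
  have e1 : {s ∈ markedLevel 0 n W | s.mark ∈ s.top₂} =
      {s : DurfeeParts | s.Marked ∧ s.mark ∈ s.top₂ ∧ s ∈ level 0 n W} := by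
    ext s; simp only [markedLevel, Set.mem_ofPred_eq]; tauto
  have e2 : {s ∈ markedLevel 0 n W | s.mark ∈ s.bot₂} =
      {s : DurfeeParts | s.Marked ∧ s.mark ∈ s.bot₂ ∧ s ∈ level 0 n W} := by
    ext s; simp only [markedLevel, Set.mem_ofPred_eq]; tauto
  have e3 : {s ∈ markedLevel 0 n W | s.mark ∈ s.top₂ ∧ s.mark ∈ s.bot₂} =
      {s : DurfeeParts | s.Marked ∧ s.mark ∈ s.top₂ ∧
        s ∈ {s : DurfeeParts | s.mark ∈ s.bot₂ ∧ s ∈ level 0 n W}} := by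
    ext s; simp only [markedLevel, Set.mem_ofPred_eq]; tauto
  have e4 : {s : DurfeeParts | s.Marked ∧
      s.addTop₂ ∈ {s : DurfeeParts | s.mark ∈ s.bot₂ ∧ s ∈ level 0 n W}} =
      {s : DurfeeParts | s.Marked ∧ s.mark ∈ s.bot₂ ∧ s ∈ level 1 n ((· + 2) ⁻¹' W)} := by
    ext s; simp only [Set.mem_ofPred_eq, addTop₂_mem_level]; rfl
  simp only [addTop₂_mem_level, addBot₂_mem_level] at h1 h2 h4
  rw [← Set.preimage_comp] at h4
  have hc : ((· + 2) ∘ (· - 2) : ℤ → ℤ) = id := by ext; simp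
  rw [hc, Set.preimage_id] at h4
  rw [e1, e2, e3, h1, h2, h3, e4, h4] at h
  exact h

/-! ### Split Durfee symbols and telescoping -/

/-- The split tuples representing `n` with rank in `W`. -/
def splitLevel (n : ℕ) (W : Set ℤ) : Set DurfeeParts :=
  {s | s.Split ∧ s.size = n ∧ s.rank ∈ W}

theorem finite_splitLevel (n : ℕ) (W : Set ℤ) : (splitLevel n W).Finite :=
  (finite_split n).subset fun _ h => ⟨h.1, h.2.1.le⟩

/-- The Durfee symbols of `n` with rank in `W`, all entries having subscript `1`. -/
def durfeeLevel (n : ℕ) (W : Set ℤ) : Set DurfeeParts :=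
  {s ∈ splitLevel n W | s.mark = s.side}

theorem finite_durfeeLevel (n : ℕ) (W : Set ℤ) : (durfeeLevel n W).Finite :=
  (finite_splitLevel n W).subset fun _ h => h.1

theorem ncard_add_ncard_not {α : Type*} {S : Set α} (hS : S.Finite) (p : α → Prop) :
    {s ∈ S | p s}.ncard + {s ∈ S | ¬ p s}.ncard = S.ncard := by
  simpa using (ncard_inclusion_exclusion hS p fun s => ¬ p s).symm

/-- If the mark is not an entry with subscript `2`, the weak lower bound on those entries becomes
strict. -/
theorem split_mark_ne_zero (n : ℕ) (W : Set ℤ) :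
    {s ∈ markedLevel 0 n W | s.mark ∉ s.top₂ ∧ s.mark ∉ s.bot₂} =
      {s ∈ splitLevel n W | ¬ s.mark = 0} := by
  ext s
  constructor
  · rintro ⟨⟨⟨⟨h0, h1⟩, h2, h3, h4, h5⟩, h6, h7⟩, h8, h9⟩
    refine ⟨⟨⟨h1, h2, h3, fun x hx => ⟨(h4 x hx).1.lt_of_ne ?_, (h4 x hx).2⟩,
      fun x hx => ⟨(h5 x hx).1.lt_of_ne ?_, (h5 x hx).2⟩⟩, by omega, h7⟩, by omega⟩
    · rintro rfl; exact h8 hx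
    · rintro rfl; exact h9 hx
  · rintro ⟨⟨⟨h1, h2, h3, h4, h5⟩, h6, h7⟩, h0⟩
    exact ⟨⟨⟨⟨by omega, h1⟩, h2, h3, fun x hx => ⟨(h4 x hx).1.le, (h4 x hx).2⟩,
      fun x hx => ⟨(h5 x hx).1.le, (h5 x hx).2⟩⟩, by omega, h7⟩,
      fun h => (h4 _ h).1.false, fun h => (h5 _ h).1.false⟩

/-- If the mark is not an entry with subscript `1`, it can be lowered by one: those entries stay
below it, and those with subscript `2` become strictly larger. The size is unaffected because level
`0` does not count the mark. -/
theorem ncard_split_mark_ne_side (n : ℕ) (W : Set ℤ) :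
    {s ∈ markedLevel 0 n W | s.mark ∉ s.top₁ ∧ s.mark ∉ s.bot₁}.ncard =
      {s ∈ splitLevel n W | ¬ s.mark = s.side}.ncard := by
  have hf : Function.Injective fun s : DurfeeParts => { s with mark := s.mark + 1 } := by
    rintro ⟨⟩ ⟨⟩ h
    simpa using h
  rw [← Set.ncard_image_of_injective {s ∈ splitLevel n W | ¬ s.mark = s.side} hf]
  congr 1
  ext s
  constructor
  · rintro ⟨⟨⟨⟨h0, h1⟩, h2, h3, h4, h5⟩, h6, h7⟩, h8, h9⟩
    refine ⟨{ s with mark := s.mark - 1 }, ⟨⟨⟨?_, ?_, ?_, ?_, ?_⟩, ?_, h7⟩, ?_⟩, ?_⟩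
    · dsimp only; omega
    · intro x hx
      have := h2 x hx
      have : x ≠ s.mark := by rintro rfl; exact h8 hx
      dsimp only; omega
    · intro x hx
      have := h3 x hx
      have : x ≠ s.mark := by rintro rfl; exact h9 hx
      dsimp only; omega
    · intro x hx
      have := h4 x hx
      dsimp only; omega
    · intro x hx
      have := h5 x hx
      dsimp only; omega
    · change s.size = n
      omega
    · dsimp only; omega
    · ext1 <;> try rfl
      dsimp only; omega
  · rintro ⟨s, ⟨⟨⟨h1, h2, h3, h4, h5⟩, h6, h7⟩, h0⟩, rfl⟩
    refine ⟨⟨⟨⟨?_, ?_⟩, ?_, ?_, h4, h5⟩, ?_, h7⟩, ?_, ?_⟩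
    · dsimp only; omega
    · dsimp only; omega
    · intro x hx
      have := h2 x hx
      dsimp only; omega
    · intro x hx
      have := h3 x hx
      dsimp only; omega
    · change s.size + 0 * (s.mark + 1) = n
      omega
    · intro h
      have := h2 _ h
      dsimp only at this; omega
    · intro h
      have := h3 _ h
      dsimp only at this; omega

theorem eq_zero_of_forall_lt_and_le {A : Multiset ℕ} {m : ℕ} (h : ∀ x ∈ A, m < x ∧ x ≤ m) :
    A = 0 :=
  Multiset.eq_zero_of_forall_notMem fun x hx => by have := h x hx; omega

/-- A cut at `0` leaves no entries with subscript `1`. Relabelling the others from `2` to `1` halves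
the rank, hence the preimage under doubling. -/
theorem ncard_split_mark_eq_zero (n : ℕ) (W : Set ℤ) :
    {s ∈ splitLevel n W | s.mark = 0}.ncard = (durfeeLevel n ((2 * ·) ⁻¹' W)).ncard := by
  refine Set.ncard_congr (fun s _ => ⟨s.side, s.side, s.top₂, s.bot₂, s.top₁, s.bot₁⟩) ?_ ?_ ?_
  · rintro ⟨d, m, A, B, C, E⟩ ⟨⟨⟨h1, h2, h3, h4, h5⟩, h6, h7⟩, h0⟩
    dsimp only at *
    subst h0
    obtain rfl : A = 0 := eq_zero_of_forall_lt_and_le (m := 0) h2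
    obtain rfl : B = 0 := eq_zero_of_forall_lt_and_le (m := 0) h3
    refine ⟨⟨⟨le_rfl, h4, h5, by simp, by simp⟩, ?_, ?_⟩, rfl⟩
    · simpa [size] using h6
    · simpa [rank] using h7
  · rintro ⟨⟩ ⟨⟩ ⟨-, h0⟩ ⟨-, h1⟩ h
    simp_all
  · rintro ⟨d, m, A, B, C, E⟩ ⟨⟨⟨h1, h2, h3, h4, h5⟩, h6, h7⟩, h0⟩
    dsimp only at *
    subst h0
    obtain rfl : C = 0 := eq_zero_of_forall_lt_and_le h4
    obtain rfl : E = 0 := eq_zero_of_forall_lt_and_le h5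
    refine ⟨⟨m, 0, 0, 0, A, B⟩, ⟨⟨⟨Nat.zero_le _, by simp, by simp, h2, h3⟩, ?_, ?_⟩, rfl⟩, rfl⟩
    · simpa [size] using h6
    · simpa [rank] using h7

/-- The coefficient form of the relation
`(z + z⁻¹ - z² - z⁻²) R₂(z, z²; q) = R(z; q) - R(z²; q)` between the generating functions of the
full ranks of `2`-marked Durfee symbols and of the ranks of Durfee symbols. -/
theorem ncard_markedLevel_relation (n : ℕ) (W : Set ℤ) :
    (markedLevel 1 n ((· + 2) ⁻¹' W)).ncard + (markedLevel 1 n ((· - 2) ⁻¹' W)).ncard +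
        (durfeeLevel n W).ncard =
      (markedLevel 1 n ((· + 1) ⁻¹' W)).ncard + (markedLevel 1 n ((· - 1) ⁻¹' W)).ncard +
        (durfeeLevel n ((2 * ·) ⁻¹' W)).ncard := by
  have h1 := ncard_markedLevel_subscript_one n W
  have h2 := ncard_markedLevel_subscript_two n W
  rw [ncard_split_mark_ne_side] at h1
  rw [split_mark_ne_zero] at h2
  -- Both restricted counts are complements inside the same `splitLevel n W`; comparing them
  -- eliminates it along with levels `0` and `2`.
  have h3 := ncard_add_ncard_not (finite_splitLevel n W) fun s => s.mark = 0
  have h4 := ncard_add_ncard_not (finite_splitLevel n W) fun s => s.mark = s.side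
  rw [ncard_split_mark_eq_zero] at h3
  change (durfeeLevel n W).ncard + _ = _ at h4
  omega

/-! ### Symmetry of the rank -/

/-- Interchange the two rows. -/
def swap (s : DurfeeParts) : DurfeeParts := ⟨s.side, s.mark, s.bot₁, s.top₁, s.bot₂, s.top₂⟩

theorem ncard_markedLevel_neg (n : ℕ) (W : Set ℤ) :
    (markedLevel 1 n (Neg.neg ⁻¹' W)).ncard = (markedLevel 1 n W).ncard := by
  have key : ∀ (V : Set ℤ) (s : DurfeeParts), s ∈ markedLevel 1 n (Neg.neg ⁻¹' V) →
      s.swap ∈ markedLevel 1 n V := by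
    rintro V s ⟨⟨h0, h1, h2, h3, h4⟩, h5, h6⟩
    refine ⟨⟨h0, h2, h1, h4, h3⟩, ?_, ?_⟩
    · rw [← h5]; simp only [size, swap]; ring
    · have : s.swap.rank = -s.rank := by simp only [rank, swap]; ring
      rw [this]; exact h6
  refine Set.ncard_congr (fun s _ => s.swap) (fun s hs => key W s hs) ?_ fun s hs =>
    ⟨s.swap, key _ s (by simpa [← Set.preimage_comp] using hs), rfl⟩
  rintro ⟨⟩ ⟨⟩ - - h
  simp only [swap, mk.injEq] at h ⊢
  tauto

end DurfeeParts

/-! ### Rows as pairs of multisets -/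

/-- The multiset of the parts with subscript `i` in a row of subscripted parts. -/
def rowParts (row : List (ℕ × ℕ)) (i : ℕ) : Multiset ℕ :=
  ((row.filter fun x => x.2 = i).map Prod.fst : List ℕ)

theorem mem_rowParts {row : List (ℕ × ℕ)} {i a : ℕ} : a ∈ rowParts row i ↔ (a, i) ∈ row := by
  simp [rowParts]

theorem card_rowParts (row : List (ℕ × ℕ)) (i : ℕ) :
    (rowParts row i).card = subscriptCount row i := by
  simp [rowParts, subscriptCount, List.countP_eq_length_filter]

theorem map_rowParts_add {row : List (ℕ × ℕ)} (h : ∀ x ∈ row, 1 ≤ x.2 ∧ x.2 ≤ 2) :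
    (rowParts row 1).map (·, 1) + (rowParts row 2).map (·, 2) = (row : Multiset (ℕ × ℕ)) := by
  induction row with
  | nil => simp [rowParts]
  | cons a l ih =>
    have ih := ih fun x hx => h x (List.mem_cons_of_mem _ hx)
    obtain ⟨p, i⟩ := a
    have hi := h (p, i) List.mem_cons_self
    dsimp only at hi
    obtain rfl | rfl : i = 1 ∨ i = 2 := by omega
    · have h1 : rowParts ((p, 1) :: l) 1 = p ::ₘ rowParts l 1 := by simp [rowParts]
      have h2 : rowParts ((p, 1) :: l) 2 = rowParts l 2 := by simp [rowParts]
      rw [h1, h2, ← Multiset.cons_coe, ← ih]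
      simp
    · have h1 : rowParts ((p, 2) :: l) 1 = rowParts l 1 := by simp [rowParts]
      have h2 : rowParts ((p, 2) :: l) 2 = p ::ₘ rowParts l 2 := by simp [rowParts]
      rw [h1, h2, ← Multiset.cons_coe, ← ih]
      simp

theorem rowSum_eq {row : List (ℕ × ℕ)} (h : ∀ x ∈ row, 1 ≤ x.2 ∧ x.2 ≤ 2) :
    rowSum row = (rowParts row 1).sum + (rowParts row 2).sum := by
  have := congrArg (fun A : Multiset (ℕ × ℕ) => (A.map Prod.fst).sum) (map_rowParts_add h)
  simp only [Multiset.map_add, Multiset.map_map, Function.comp_def, Multiset.map_id',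
    Multiset.sum_add, Multiset.map_coe, Multiset.sum_coe] at this
  exact this.symm

/-- The order on entries is antisymmetric, so a sorted row is determined by its multiset of entries.
-/
theorem row_ext {l₁ l₂ : List (ℕ × ℕ)} (h₁ : ∀ x ∈ l₁, 1 ≤ x.2 ∧ x.2 ≤ 2)
    (h₂ : ∀ x ∈ l₂, 1 ≤ x.2 ∧ x.2 ≤ 2)
    (s₁ : l₁.Pairwise fun x y => y.1 ≤ x.1 ∧ y.2 ≤ x.2)
    (s₂ : l₂.Pairwise fun x y => y.1 ≤ x.1 ∧ y.2 ≤ x.2)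
    (e₁ : rowParts l₁ 1 = rowParts l₂ 1) (e₂ : rowParts l₁ 2 = rowParts l₂ 2) : l₁ = l₂ := by
  have hp : l₁.Perm l₂ := by
    rw [← Multiset.coe_eq_coe, ← map_rowParts_add h₁, ← map_rowParts_add h₂, e₁, e₂]
  refine hp.eq_of_pairwise ?_ s₁ s₂
  rintro a b - - ⟨h1, h2⟩ ⟨h3, h4⟩
  exact Prod.ext (le_antisymm h3 h1) (le_antisymm h4 h2)

theorem le_largestPart {row : List (ℕ × ℕ)} {a i : ℕ} (h : (a, i) ∈ row) :
    a ≤ largestPart row i := by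
  have h' : a ∈ (row.filter fun x => x.2 = i).map Prod.fst := by simpa using h
  unfold largestPart
  generalize (row.filter fun x => x.2 = i).map Prod.fst = l at h'
  induction l with
  | nil => simp at h'
  | cons b l ih =>
    rcases List.mem_cons.1 h' with rfl | h'
    · simp
    · exact (ih h').trans (by simp)

theorem largestPart_mem {row : List (ℕ × ℕ)} {i : ℕ} (h : ∃ x ∈ row, x.2 = i) :
    (largestPart row i, i) ∈ row := by
  have key : ∀ l : List ℕ, l ≠ [] → l.foldr max 0 ∈ l := by
    intro l
    induction l with
    | nil => simp
    | cons b l ih =>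
      intro _
      rcases eq_or_ne l [] with rfl | hl
      · simp
      · rw [List.foldr_cons]
        rcases max_choice b (l.foldr max 0) with h | h <;> rw [h]
        · exact List.mem_cons_self
        · exact List.mem_cons_of_mem _ (ih hl)
  have := key ((row.filter fun x => x.2 = i).map Prod.fst) (by
    obtain ⟨x, hx, rfl⟩ := h
    exact List.ne_nil_of_mem (a := x.1) (List.mem_map.2 ⟨x, by simpa using hx, rfl⟩))
  simpa [largestPart] using this

/-- The non-increasing row with parts `A` of subscript `1` and parts `C` of subscript `2`. -/
noncomputable def mkRow (A C : Multiset ℕ) : List (ℕ × ℕ) :=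
  (C.sort (· ≥ ·)).map (·, 2) ++ (A.sort (· ≥ ·)).map (·, 1)

theorem mem_mkRow {A C : Multiset ℕ} {x : ℕ × ℕ} :
    x ∈ mkRow A C ↔ (x.2 = 2 ∧ x.1 ∈ C) ∨ (x.2 = 1 ∧ x.1 ∈ A) := by
  obtain ⟨a, i⟩ := x
  simp only [mkRow, List.mem_append, List.mem_map, Multiset.mem_sort, Prod.mk.injEq]
  aesop

theorem pairwise_mkRow {A C : Multiset ℕ} (h : ∀ a ∈ A, ∀ c ∈ C, a ≤ c) :
    (mkRow A C).Pairwise fun x y => y.1 ≤ x.1 ∧ y.2 ≤ x.2 := by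
  have hs : ∀ D : Multiset ℕ, (D.sort (· ≥ ·)).Pairwise (· ≥ ·) :=
    fun D => Multiset.pairwise_sort D _
  refine List.pairwise_append.2 ⟨?_, ?_, ?_⟩
  · exact List.pairwise_map.2 ((hs C).imp fun h => ⟨h, le_rfl⟩)
  · exact List.pairwise_map.2 ((hs A).imp fun h => ⟨h, le_rfl⟩)
  · intro x hx y hy
    simp only [List.mem_map, Multiset.mem_sort] at hx hy
    obtain ⟨c, hc, rfl⟩ := hx
    obtain ⟨a, ha, rfl⟩ := hy
    exact ⟨h a ha c hc, by norm_num⟩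

theorem rowParts_mkRow_one (A C : Multiset ℕ) : rowParts (mkRow A C) 1 = A := by
  simp [rowParts, mkRow, List.filter_map, Function.comp_def]

theorem rowParts_mkRow_two (A C : Multiset ℕ) : rowParts (mkRow A C) 2 = C := by
  simp [rowParts, mkRow, List.filter_map, Function.comp_def]

/-! ### Marked symbols as marked tuples -/

namespace MarkedDurfeeSymbol

theorem largestPart_mem_rowParts (δ : MarkedDurfeeSymbol 2) :
    largestPart δ.top 1 ∈ rowParts δ.top 1 :=
  mem_rowParts.2 (largestPart_mem (δ.subscript_occurs 1 le_rfl (by norm_num)))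

/-- The entries of a `2`-marked Durfee symbol sorted by row and subscript. -/
def toParts (δ : MarkedDurfeeSymbol 2) : DurfeeParts where
  side := δ.side
  mark := largestPart δ.top 1
  top₁ := (rowParts δ.top 1).erase (largestPart δ.top 1)
  bot₁ := rowParts δ.bottom 1
  top₂ := rowParts δ.top 2
  bot₂ := rowParts δ.bottom 2

theorem size_eq (δ : MarkedDurfeeSymbol 2) : δ.size = δ.toParts.size + δ.toParts.mark := by
  have h := congrArg Multiset.sum (Multiset.cons_erase δ.largestPart_mem_rowParts)
  rw [Multiset.sum_cons] at h
  simp only [size, DurfeeParts.size, toParts, rowSum_eq δ.top_subscript_mem,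
    rowSum_eq δ.bottom_subscript_mem]
  omega

/-- The `-1` in the first rank is exactly the copy of the largest part set aside as `mark`. -/
theorem fullRank_eq (δ : MarkedDurfeeSymbol 2) : δ.fullRank = δ.toParts.rank := by
  have h := congrArg Multiset.card (Multiset.cons_erase δ.largestPart_mem_rowParts)
  rw [Multiset.card_cons] at h
  have h2 : Finset.Icc 1 2 = ({1, 2} : Finset ℕ) := rfl
  rw [fullRank, h2, Finset.sum_pair (by norm_num)]
  simp only [rank, DurfeeParts.rank, toParts, ← card_rowParts, ← h]
  norm_num
  ring

theorem marked_toParts (δ : MarkedDurfeeSymbol 2) : δ.toParts.Marked := by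
  have hM := mem_rowParts.1 δ.largestPart_mem_rowParts
  refine ⟨δ.top_part_mem _ hM, ?_, ?_, ?_, ?_⟩
  · intro x hx
    have hx := mem_rowParts.1 (Multiset.mem_of_mem_erase hx)
    exact ⟨(δ.top_part_mem _ hx).1, le_largestPart hx⟩
  · intro x hx
    have hx := mem_rowParts.1 hx
    exact ⟨(δ.bottom_part_mem _ hx).1, δ.bottom_le _ hx (by norm_num)⟩
  · intro x hx
    have hx := mem_rowParts.1 hx
    refine ⟨?_, (δ.top_part_mem _ hx).2⟩
    -- The order of the two entries in the row is unknown, so the sorting is weakened to a relation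
    -- valid both ways round: a larger subscript goes with a part at least as large.
    have h3 := (δ.top_nonincreasing.imp (S := fun x y : ℕ × ℕ =>
      (x.2 < y.2 → x.1 ≤ y.1) ∧ (y.2 < x.2 → y.1 ≤ x.1)) fun h =>
        ⟨fun h' => absurd h.2 (not_le.2 h'), fun _ => h.1⟩).forall_of_forall_of_flip
      (fun _ _ => ⟨fun _ => le_rfl, fun _ => le_rfl⟩)
      (δ.top_nonincreasing.imp fun h => ⟨fun _ => h.1, fun h' => absurd h.2 (not_le.2 h')⟩) hM hx
    exact h3.1 (by norm_num)
  · intro x hx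
    have hx := mem_rowParts.1 hx
    exact ⟨δ.le_bottom _ hx le_rfl, (δ.bottom_part_mem _ hx).2⟩

theorem toParts_injective : Function.Injective toParts := by
  intro δ ε h
  have h1 : δ.side = ε.side := congrArg DurfeeParts.side h
  have h2 : largestPart δ.top 1 = largestPart ε.top 1 := congrArg DurfeeParts.mark h
  have h3 : (rowParts δ.top 1).erase (largestPart δ.top 1) =
    (rowParts ε.top 1).erase (largestPart ε.top 1) := congrArg DurfeeParts.top₁ h
  have h4 : rowParts δ.bottom 1 = rowParts ε.bottom 1 := congrArg DurfeeParts.bot₁ h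
  have h5 : rowParts δ.top 2 = rowParts ε.top 2 := congrArg DurfeeParts.top₂ h
  have h6 : rowParts δ.bottom 2 = rowParts ε.bottom 2 := congrArg DurfeeParts.bot₂ h
  have h7 : rowParts δ.top 1 = rowParts ε.top 1 := by
    rw [← Multiset.cons_erase δ.largestPart_mem_rowParts, h3, h2,
      Multiset.cons_erase ε.largestPart_mem_rowParts]
  exact MarkedDurfeeSymbol.ext h1
    (row_ext δ.top_subscript_mem ε.top_subscript_mem δ.top_nonincreasing ε.top_nonincreasing h7 h5)
    (row_ext δ.bottom_subscript_mem ε.bottom_subscript_mem δ.bottom_nonincreasing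
      ε.bottom_nonincreasing h4 h6)

theorem exists_toParts_eq {s : DurfeeParts} (hs : s.Marked) :
    ∃ δ : MarkedDurfeeSymbol 2, δ.toParts = s := by
  obtain ⟨⟨h0, h0'⟩, h1, h2, h3, h4⟩ := hs
  have hA : ∀ x ∈ s.mark ::ₘ s.top₁, 1 ≤ x ∧ x ≤ s.mark := by
    simpa [h0] using h1
  have hmem : (s.mark, 1) ∈ mkRow (s.mark ::ₘ s.top₁) s.top₂ := mem_mkRow.2 (Or.inr (by simp))
  have hM : largestPart (mkRow (s.mark ::ₘ s.top₁) s.top₂) 1 = s.mark := by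
    refine le_antisymm ?_ (le_largestPart hmem)
    have := largestPart_mem ⟨_, hmem, rfl⟩
    rcases mem_mkRow.1 this with h | h
    · simp at h
    · exact (hA _ h.2).2
  refine ⟨{
    side := s.side
    top := mkRow (s.mark ::ₘ s.top₁) s.top₂
    bottom := mkRow s.bot₁ s.bot₂
    top_part_mem := ?_
    bottom_part_mem := ?_
    top_subscript_mem := ?_
    bottom_subscript_mem := ?_
    top_nonincreasing := pairwise_mkRow fun a ha c hc => (hA a ha).2.trans (h3 c hc).1
    bottom_nonincreasing := pairwise_mkRow fun a ha c hc => (h2 a ha).2.trans (h4 c hc).1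
    subscript_occurs := ?_
    le_bottom := ?_
    bottom_le := ?_ }, ?_⟩
  · intro x hx
    rcases mem_mkRow.1 hx with h | h
    · have := h3 _ h.2; omega
    · have := hA _ h.2; omega
  · intro x hx
    rcases mem_mkRow.1 hx with h | h
    · have := h4 _ h.2; omega
    · have := h2 _ h.2; omega
  · intro x hx
    rcases mem_mkRow.1 hx with h | h <;> omega
  · intro x hx
    rcases mem_mkRow.1 hx with h | h <;> omega
  · intro i hi hi'
    obtain rfl : i = 1 := by omega
    exact ⟨_, hmem, rfl⟩
  · intro x hx hx2
    rcases mem_mkRow.1 hx with h | h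
    · rw [h.1, hM]; exact (h4 _ h.2).1
    · omega
  · intro x hx hx2
    rcases mem_mkRow.1 hx with h | h
    · omega
    · rw [h.1, hM]; exact (h2 _ h.2).2
  · ext1 <;> simp [toParts, hM, rowParts_mkRow_one, rowParts_mkRow_two]

theorem ncard_size_fullRank (n : ℕ) (W : Set ℤ) :
    {δ : MarkedDurfeeSymbol 2 | δ.size = n ∧ δ.fullRank ∈ W}.ncard =
      (DurfeeParts.markedLevel 1 n W).ncard := by
  rw [← Set.ncard_image_of_injective _ toParts_injective]
  congr 1
  ext s
  constructor
  · rintro ⟨δ, ⟨h1, h2⟩, rfl⟩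
    refine ⟨δ.marked_toParts, ?_, ?_⟩
    · rw [one_mul, ← size_eq, h1]
    · rwa [← fullRank_eq]
  · rintro ⟨h0, h1, h2⟩
    obtain ⟨δ, rfl⟩ := exists_toParts_eq h0
    refine ⟨δ, ⟨?_, ?_⟩, rfl⟩
    · rw [size_eq, ← h1, one_mul]
    · rwa [fullRank_eq]

end MarkedDurfeeSymbol

/-! ### Durfee symbols with rank congruent to `s` modulo `2s` -/

namespace DurfeeParts

theorem durfeeLevel_nonempty_iff {n s : ℕ} (hs : 0 < s) :
    (durfeeLevel n {r | r ≡ s [ZMOD (2 * s : ℕ)]}).Nonempty ↔ ¬ (n ≤ s ∨ n = s + 2) := by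
  constructor
  · rintro ⟨⟨d, m, A, B, C, E⟩, ⟨⟨-, h2, h3, h4, h5⟩, h6, h7⟩, h0⟩
    dsimp only at *
    subst h0
    obtain rfl : C = 0 := eq_zero_of_forall_lt_and_le h4
    obtain rfl : E = 0 := eq_zero_of_forall_lt_and_le h5
    simp only [size, Multiset.sum_zero, add_zero] at h6
    simp only [rank, Multiset.card_zero, Set.mem_ofPred_eq, Nat.cast_zero, sub_zero, mul_zero,
      add_zero] at h7
    have hA : A.card ≤ A.sum := by
      simpa using Multiset.card_nsmul_le_sum (s := A) (a := 1) fun x hx => (h2 x hx).1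
    have hB : B.card ≤ B.sum := by
      simpa using Multiset.card_nsmul_le_sum (s := B) (a := 1) fun x hx => (h3 x hx).1
    have hA' : A.sum ≤ A.card * m := by
      simpa using Multiset.sum_le_card_nsmul A m fun x hx => (h2 x hx).2
    have hB' : B.sum ≤ B.card * m := by
      simpa using Multiset.sum_le_card_nsmul B m fun x hx => (h3 x hx).2
    obtain ⟨c, hc⟩ := h7.symm.dvd
    push_cast at hc
    -- The rank is the odd multiple `s (1 + 2c)` of `s`, so its absolute value is at least `s`; its
    -- parity gives `hpar`.
    have hab : s ≤ A.card + B.card := by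
      rcases le_or_gt 0 c with h | h
      · have : 0 ≤ (s : ℤ) * c := by positivity
        have : (s : ℤ) ≤ A.card := by nlinarith
        omega
      · have : (s : ℤ) * c ≤ s * (-1) := by
          apply mul_le_mul_of_nonneg_left <;> omega
        have : (s : ℤ) ≤ B.card := by nlinarith
        omega
    have hpar : (A.card + B.card) % 2 = s % 2 := by
      have : (A.card : ℤ) - B.card = s + 2 * (s * c) := by linarith
      omega
    -- Side `0` allows no parts, contradicting `0 < s`. Side `1` makes all parts `1`, so `n - s` is
    -- odd and positive. Side at least `2` gives `n ≥ s + 4`.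
    obtain rfl | rfl | hm : m = 0 ∨ m = 1 ∨ 2 ≤ m := by omega
    · omega
    · omega
    · have : 2 ^ 2 ≤ m ^ 2 := Nat.pow_le_pow_left hm 2
      omega
  · intro h
    have key : ∀ d j : ℕ, 1 ≤ d → d ^ 2 + s + 2 * j = n →
        (durfeeLevel n {r | r ≡ s [ZMOD (2 * s : ℕ)]}).Nonempty := by
      intro d j hd hn
      refine ⟨⟨d, d, Multiset.replicate (s + j) 1, Multiset.replicate j 1, 0, 0⟩,
        ⟨⟨le_rfl, ?_, ?_, by simp, by simp⟩, ?_, ?_⟩, rfl⟩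
      · intro x hx
        rw [Multiset.eq_of_mem_replicate hx]
        exact ⟨le_rfl, hd⟩
      · intro x hx
        rw [Multiset.eq_of_mem_replicate hx]
        exact ⟨le_rfl, hd⟩
      · simp [size]
        omega
      · simp [rank]
    -- An even `n - s` is at least `4` and is met by side `2`; an odd one is met by side `1`. The
    -- surplus is filled by pairs of ones, one in each row, which do not change the rank.
    rcases Nat.even_or_odd' (n - s) with ⟨j, hj | hj⟩
    · exact key 2 (j - 2) (by norm_num) (by omega)
    · exact key 1 j le_rfl (by omega)

/-- Writing `2r = 2s c`, the parity of `c` decides between the two residues. -/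
theorem two_mul_modEq_zero_iff (r : ℤ) (s : ℕ) :
    2 * r ≡ 0 [ZMOD (2 * s : ℕ)] ↔ r ≡ 0 [ZMOD (2 * s : ℕ)] ∨ r ≡ s [ZMOD (2 * s : ℕ)] := by
  push_cast
  constructor
  · intro h
    obtain ⟨c, hc⟩ := Int.modEq_zero_iff_dvd.1 h
    obtain ⟨e, rfl | rfl⟩ := Int.even_or_odd' c
    · exact Or.inl (Int.modEq_zero_iff_dvd.2 ⟨e, by linarith⟩)
    · exact Or.inr (Int.modEq_iff_dvd.2 ⟨-e, by linarith⟩)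
  · rintro (h | h)
    · exact Int.modEq_zero_iff_dvd.2 ((Int.modEq_zero_iff_dvd.1 h).mul_left 2)
    · obtain ⟨c, hc⟩ := Int.modEq_iff_dvd.1 h
      exact Int.modEq_zero_iff_dvd.2 ⟨1 - 2 * c, by linarith⟩

theorem not_zero_modEq_two_mul {s : ℕ} (hs : 0 < s) : ¬ (0 : ℤ) ≡ s [ZMOD (2 * s : ℕ)] := by
  intro h
  have h' := h.symm
  rw [Int.modEq_zero_iff_dvd, Int.natCast_dvd_natCast] at h'
  have := Nat.le_of_dvd hs h'
  omega

theorem ncard_durfeeLevel_modEq (n : ℕ) {s : ℕ} (hs : 0 < s) :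
    (durfeeLevel n {r | 2 * r ≡ 0 [ZMOD (2 * s : ℕ)]}).ncard =
      (durfeeLevel n {r | r ≡ 0 [ZMOD (2 * s : ℕ)]}).ncard +
      (durfeeLevel n {r | r ≡ s [ZMOD (2 * s : ℕ)]}).ncard := by
  rw [← Set.ncard_union_eq ?_ (finite_durfeeLevel _ _) (finite_durfeeLevel _ _)]
  · congr 1
    ext u
    simp only [durfeeLevel, splitLevel, Set.mem_union, Set.mem_ofPred_eq]
    rw [two_mul_modEq_zero_iff]
    tauto
  · refine Set.disjoint_left.2 ?_
    rintro u ⟨⟨-, -, h1⟩, -⟩ ⟨⟨-, -, h2⟩, -⟩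
    exact not_zero_modEq_two_mul hs (h1.symm.trans h2)

end DurfeeParts

/-! ### Counts of full ranks and the conclusion -/

theorem fullRankModCount_two_eq (r : ℤ) (t n : ℕ) :
    fullRankModCount 2 r t n = (DurfeeParts.markedLevel 1 n {x | x ≡ r [ZMOD t]}).ncard :=
  MarkedDurfeeSymbol.ncard_size_fullRank n {x | x ≡ r [ZMOD t]}

theorem fullRankCount_two_eq (r : ℤ) (n : ℕ) :
    fullRankCount 2 r n = (DurfeeParts.markedLevel 1 n {x | x = r}).ncard :=
  MarkedDurfeeSymbol.ncard_size_fullRank n {x | x = r}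

theorem fullRankModCount_neg (r : ℤ) (t n : ℕ) :
    fullRankModCount 2 (-r) t n = fullRankModCount 2 r t n := by
  rw [fullRankModCount_two_eq, fullRankModCount_two_eq, ← DurfeeParts.ncard_markedLevel_neg]
  congr 2
  ext x
  exact ⟨fun h => by simpa using h.neg, fun h => by simpa using h.neg⟩

theorem fullRankCount_neg (r : ℤ) (n : ℕ) : fullRankCount 2 (-r) n = fullRankCount 2 r n := by
  rw [fullRankCount_two_eq, fullRankCount_two_eq, ← DurfeeParts.ncard_markedLevel_neg]
  congr 2
  ext x
  exact neg_inj

/-- The relation for ranks divisible by `t` involves the residues `±1` and `±2`; the symmetry merges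
each pair, hence the factors of two. -/
theorem two_mul_fullRankModCount (t n : ℕ) :
    2 * fullRankModCount 2 2 t n + (DurfeeParts.durfeeLevel n {r | r ≡ 0 [ZMOD t]}).ncard =
      2 * fullRankModCount 2 1 t n +
        (DurfeeParts.durfeeLevel n {r | 2 * r ≡ 0 [ZMOD t]}).ncard := by
  have h := DurfeeParts.ncard_markedLevel_relation n {r | r ≡ 0 [ZMOD t]}
  have e : ∀ a : ℤ, (· + a) ⁻¹' {r : ℤ | r ≡ 0 [ZMOD t]} = {x | x ≡ -a [ZMOD t]} := by
    intro a
    ext x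
    simp only [Set.mem_preimage, Set.mem_ofPred_eq]
    exact ⟨fun h => by simpa using h.add_right (-a), fun h => by simpa using h.add_right a⟩
  simp only [sub_eq_add_neg] at h
  rw [e, e, e, e, ← fullRankModCount_two_eq, ← fullRankModCount_two_eq,
    ← fullRankModCount_two_eq, ← fullRankModCount_two_eq, neg_neg, neg_neg, fullRankModCount_neg,
    fullRankModCount_neg, ← two_mul, ← two_mul] at h
  exact h

theorem theorem1p3 :
    (∀ t : ℕ, Odd t → ∀ n : ℕ, fullRankModCount 2 1 t n = fullRankModCount 2 2 t n) ∧
    (∀ t : ℕ, 0 < t → Even t → ∀ n : ℕ,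
      fullRankModCount 2 1 t n ≤ fullRankModCount 2 2 t n ∧
      (fullRankModCount 2 1 t n = fullRankModCount 2 2 t n ↔ n ≤ t / 2 ∨ n = t / 2 + 2)) ∧
    (∀ n : ℕ, fullRankCount 2 1 n = fullRankCount 2 2 n) := by
  refine ⟨fun t ht n => ?_, fun t ht0 ht n => ?_, fun n => ?_⟩
  · have h := two_mul_fullRankModCount t n
    have e : {r : ℤ | 2 * r ≡ 0 [ZMOD t]} = {r : ℤ | r ≡ 0 [ZMOD t]} := by
      ext r
      simp only [Set.mem_ofPred_eq, Int.modEq_zero_iff_dvd]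
      refine ⟨fun h => ?_, fun h => h.mul_left 2⟩
      refine IsCoprime.dvd_of_dvd_mul_left ?_ h
      exact_mod_cast Nat.isCoprime_iff_coprime.2 (Nat.coprime_two_right.2 ht)
    rw [e] at h
    omega
  · obtain ⟨s, rfl⟩ := ht
    rw [← two_mul] at ht0 ⊢
    have h := two_mul_fullRankModCount (2 * s) n
    rw [DurfeeParts.ncard_durfeeLevel_modEq n (by omega)] at h
    have hs : 2 * s / 2 = s := by omega
    have h1 := DurfeeParts.durfeeLevel_nonempty_iff (n := n) (s := s) (by omega)
    rw [← Set.ncard_pos (DurfeeParts.finite_durfeeLevel _ _)] at h1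
    rw [hs]
    refine ⟨by omega, ?_⟩
    -- Equality fails exactly when the number of Durfee symbols of rank `s` modulo `2s` is positive.
    rw [← not_iff_not, ← h1]
    omega
  · have h := DurfeeParts.ncard_markedLevel_relation n {r | r = 0}
    have e : ∀ a : ℤ, (· + a) ⁻¹' {r : ℤ | r = 0} = {x | x = -a} := by
      intro a
      ext x
      exact eq_neg_iff_add_eq_zero.symm
    have e' : (2 * ·) ⁻¹' {r : ℤ | r = 0} = {x | x = 0} := by
      ext x
      simp
    simp only [sub_eq_add_neg] at h
    rw [e, e, e, e, e', ← fullRankCount_two_eq, ← fullRankCount_two_eq, ← fullRankCount_two_eq,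
      ← fullRankCount_two_eq, neg_neg, neg_neg, fullRankCount_neg, fullRankCount_neg] at h
    omega
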